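/- Let $\mathcal C$ be a category with finite colimits, regarded as a symmetric monoidal category $(\mathcal C,+)$ under coproduct, let $(\mathcal D,\otimes,I)$ be a braided monoidal category, and let $(F,\varphi)\colon(\mathcal C,+)\to(\mathcal D,\otimes)$ be a braided lax monoidal functor. The hypergraph category $F\mathrm{Cospan}$ has as objects the objects of $\mathcal C$. A morphism $X\to Y$ is an isomorphism class of $F$-decorated cospans, that is, of cospans $X\xrightarrow{i}N\xleftarrow{o}Y$ in $\mathcal C$ together with a morphism $s\colon I\to FN$ of $\mathcal D$; an isomorphism of decorated cospans is an isomorphism $n\colon N\to N'$ of $\mathcal C$ commuting with the legs and satisfying $Fn\circ s=s'$. The composite of $(X\to N\leftarrow Y,s)$ and $(Y\to M\leftarrow Z,t)$ is the pushout cospan $X\to N+_YM\leftarrow Z$ with decoration $$I\xrightarrow{\lambda^{-1}}I\otimes I\xrightarrow{s\otimes t}FN\otimes FM\xrightarrow{\varphi_{N,M}}F(N+M)\xrightarrow{F[j_N,j_M]}F(N+_YM),$$ where $j_N,j_M$ are the pushout maps. The monoidal product is the coproduct in $\mathcal C$, with decoration $\varphi_{N,M}\circ(s\otimes t)\circ\lambda^{-1}$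 on morphisms. The coherence maps are those of $(\mathcal C,+)$, viewed as cospans with empty decoration $I\xrightarrow{\varphi_I}F\varnothing\xrightarrow{F!}FN$, and the special commutative Frobenius structure on each object is given by the cospans $\mu=[1,1]$, $\eta={!}$, $\delta=[1,1]^{\mathrm{op}}$, $\epsilon={!}^{\mathrm{op}}$ with empty decoration. Here $f\colon X\to Y$ is viewed as the cospan $X\xrightarrow{f}Y\xleftarrow{1}Y$, and $f^{\mathrm{op}}$ as $Y\xrightarrow{1}Y\xleftarrow{f}X$. Let $\mathcal D(I,-)\colon(\mathcal D,\otimes)\to(\mathrm{Set},\times)$ be the hom functor, with its braided lax monoidal structure $*\mapsto 1_I$, $(p,q)\mapsto(p\otimes q)\circ\lambda^{-1}$, and let $\mathcal D(I,F-)\colon(\mathcal C,+)\to(\mathrm{Set},\times)$ be the composite braided lax monoidal functor. Then $F\mathrm{Cospan}$ and $\mathcal D(I,F-)\mathrm{Cospan}$ are isomorphic as hypergraph categories: there are mutually inverse hypergraph functors (strong symmetric monoidal functors preserving the chosen Frobenius structures) between them. -/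

import Mathlib

open CategoryTheory MonoidalCategory Limits Opposite

universe v v' v'' v₁ v₂ u u' u'' u₁ u₂

/-! ### Hypergraph categories and hypergraph functors -/

section Hypergraph

/-- A special commutative Frobenius monoid structure on an object `X` of a braided monoidal
category: a monoid and a comonoid structure (associativity, unitality and their duals are the
fields of `MonObj` and `ComonObj`), commutative and cocommutative, subject to the Frobenius law
and the special law. -/
structure SpecialCommFrobenius {A : Type u} [Category.{v} A] [MonoidalCategory A]
    [BraidedCategory A] (X : A) extends MonObj X, ComonObj X where
  mul_comm : (β_ X X).hom ≫ mul = mul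
  comul_comm : comul ≫ (β_ X X).hom = comul
  frobenius_left : (X ◁ comul) ≫ (α_ X X X).inv ≫ (mul ▷ X) = mul ≫ comul
  frobenius_right : (comul ▷ X) ≫ (α_ X X X).hom ≫ (X ◁ mul) = mul ≫ comul
  special : comul ≫ mul = 𝟙 X

/-- A hypergraph category: a symmetric monoidal category in which every object is equipped with
a special commutative Frobenius structure, compatibly with the monoidal product.  Here
`tensorμ X₁ X₂ Y₁ Y₂` is the map exchanging the two middle factors of
`(X₁ ⊗ X₂) ⊗ (Y₁ ⊗ Y₂)` by the braiding. -/
class HypergraphCategory (A : Type u) [Category.{v} A] [MonoidalCategory A]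
    [SymmetricCategory A] where
  frob (X : A) : SpecialCommFrobenius X
  mul_tensor (X Y : A) :
    (frob (X ⊗ Y)).mul = tensorμ X Y X Y ≫ ((frob X).mul ⊗ₘ (frob Y).mul)
  one_tensor (X Y : A) :
    (frob (X ⊗ Y)).one = (λ_ (𝟙_ A)).inv ≫ ((frob X).one ⊗ₘ (frob Y).one)
  comul_tensor (X Y : A) :
    (frob (X ⊗ Y)).comul = ((frob X).comul ⊗ₘ (frob Y).comul) ≫ tensorμ X X Y Y
  counit_tensor (X Y : A) :
    (frob (X ⊗ Y)).counit = ((frob X).counit ⊗ₘ (frob Y).counit) ≫ (λ_ (𝟙_ A)).hom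

open HypergraphCategory

/-- A hypergraph functor: a strong symmetric monoidal functor (`Functor.Braided`; its structure
maps are `ε, μ` with inverses `η, δ`) that carries the Frobenius structure of each object `X` to
the Frobenius structure of its image. -/
structure HypergraphFunctor
    (A : Type u) [Category.{v} A] [MonoidalCategory A] [SymmetricCategory A]
    [HypergraphCategory A]
    (B : Type u') [Category.{v'} B] [MonoidalCategory B] [SymmetricCategory B]
    [HypergraphCategory B] extends A ⥤ B where
  braided : toFunctor.Braided
  map_mul (X : A) : (frob (obj X)).mul = Functor.LaxMonoidal.μ toFunctor X X ≫ map (frob X).mul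
  map_one (X : A) : (frob (obj X)).one = Functor.LaxMonoidal.ε toFunctor ≫ map (frob X).one
  map_comul (X : A) :
    (frob (obj X)).comul = map (frob X).comul ≫ Functor.OplaxMonoidal.δ toFunctor X X
  map_counit (X : A) :
    (frob (obj X)).counit = map (frob X).counit ≫ Functor.OplaxMonoidal.η toFunctor

namespace HypergraphFunctor

attribute [instance] HypergraphFunctor.braided

/-- The identity hypergraph functor. -/
def id (A : Type u) [Category.{v} A] [MonoidalCategory A] [SymmetricCategory A]
    [HypergraphCategory A] : HypergraphFunctor A A where
  toFunctor := 𝟭 A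
  braided := inferInstance
  map_mul X := by simp
  map_one X := by simp
  map_comul X := by simp
  map_counit X := by simp

variable {A : Type u} [Category.{v} A] [MonoidalCategory A] [SymmetricCategory A]
    [HypergraphCategory A]
  {B : Type u'} [Category.{v'} B] [MonoidalCategory B] [SymmetricCategory B]
    [HypergraphCategory B]
  {E : Type u''} [Category.{v''} E] [MonoidalCategory E] [SymmetricCategory E]
    [HypergraphCategory E]

/-- Composition of hypergraph functors, with the usual composite monoidal structure. -/
def comp (S : HypergraphFunctor A B) (T : HypergraphFunctor B E) : HypergraphFunctor A E where
  toFunctor := S.toFunctor ⋙ T.toFunctor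
  braided := inferInstance
  map_mul X := by simp [T.map_mul, S.map_mul]
  map_one X := by simp [T.map_one, S.map_one]
  map_comul X := by simp [T.map_comul, S.map_comul]
  map_counit X := by simp [T.map_counit, S.map_counit]

end HypergraphFunctor

/-- Two hypergraph categories are isomorphic if there are mutually inverse hypergraph functors
between them.  The equations are equations of hypergraph functors, so that they also involve the
monoidal structure maps. -/
def HypergraphIsomorphic
    (A : Type u) [Category.{v} A] [MonoidalCategory A] [SymmetricCategory A]
    [HypergraphCategory A]
    (B : Type u') [Category.{v'} B] [MonoidalCategory B] [SymmetricCategory B]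
    [HypergraphCategory B] : Prop :=
  ∃ (S : HypergraphFunctor A B) (T : HypergraphFunctor B A),
    S.comp T = HypergraphFunctor.id A ∧ T.comp S = HypergraphFunctor.id B

end Hypergraph

/-! ### The hom functor from the monoidal unit is lax braided -/

section HomFunctor

/-- The functor `D(I, -)` to types, with Mathlib's lax monoidal structure: unit map
`* ↦ 𝟙 I` and multiplication `(p, q) ↦ λ⁻¹ ≫ (p ⊗ q)`.  It is braided. -/
instance coyonedaUnitLaxBraided (D : Type u₂) [Category.{v₂} D] [MonoidalCategory D]
    [BraidedCategory D] : (coyoneda.obj (op (𝟙_ D))).LaxBraided where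
  braided X Y := by
    ext ⟨p, q⟩
    change ((λ_ (𝟙_ D)).inv ≫ (p ⊗ₘ q)) ≫ (β_ X Y).hom = (λ_ (𝟙_ D)).inv ≫ (q ⊗ₘ p)
    rw [Category.assoc, BraidedCategory.braiding_naturality]
    simp [unitors_inv_equal]

end HomFunctor

/-! ### The monoidal category `(C, +)`

A category with finite colimits is considered with the symmetric monoidal structure given by its
coproducts: `X ⊗ Y` is `X ⨿ Y` and `𝟙_ C` is `⊥_ C`.  The low priority makes sure that this is
used only for categories that carry no other monoidal structure. -/

attribute [local instance 50] monoidalOfHasFiniteCoproducts symmetricOfHasFiniteCoproducts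

attribute [-simp] monoidalOfHasFiniteCoproducts.tensorObj
  monoidalOfHasFiniteCoproducts.tensorHom monoidalOfHasFiniteCoproducts.whiskerLeft
  monoidalOfHasFiniteCoproducts.whiskerRight monoidalOfHasFiniteCoproducts.leftUnitor_hom
  monoidalOfHasFiniteCoproducts.rightUnitor_hom monoidalOfHasFiniteCoproducts.leftUnitor_inv
  monoidalOfHasFiniteCoproducts.rightUnitor_inv symmetricOfHasFiniteCoproducts_braiding

namespace Coprod

variable {C : Type u₁} [Category.{v₁} C] [HasFiniteColimits C]

/-- The first coproduct inclusion. -/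
noncomputable def inl (X Y : C) : X ⟶ X ⊗ Y := (coprod.inl : X ⟶ X ⨿ Y)

/-- The second coproduct inclusion. -/
noncomputable def inr (X Y : C) : Y ⟶ X ⊗ Y := (coprod.inr : Y ⟶ X ⨿ Y)

/-- The copairing `[f, g]`. -/
noncomputable def copair {X Y Z : C} (f : X ⟶ Z) (g : Y ⟶ Z) : X ⊗ Y ⟶ Z :=
  (coprod.desc f g : X ⨿ Y ⟶ Z)

/-- The unique map from the initial object. -/
noncomputable def bang (X : C) : 𝟙_ C ⟶ X := (initial.to X : ⊥_ C ⟶ X)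


variable {X Y Z X' Y' Z' W : C}

@[simp] lemma inl_copair (f : X ⟶ Z) (g : Y ⟶ Z) : inl X Y ≫ copair f g = f :=
  coprod.inl_desc f g

@[simp] lemma inr_copair (f : X ⟶ Z) (g : Y ⟶ Z) : inr X Y ≫ copair f g = g :=
  coprod.inr_desc f g

@[simp] lemma inl_copair_assoc (f : X ⟶ Z) (g : Y ⟶ Z) (h : Z ⟶ W) :
    inl X Y ≫ copair f g ≫ h = f ≫ h := by rw [← Category.assoc, inl_copair]

@[simp] lemma inr_copair_assoc (f : X ⟶ Z) (g : Y ⟶ Z) (h : Z ⟶ W) :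
    inr X Y ≫ copair f g ≫ h = g ≫ h := by rw [← Category.assoc, inr_copair]

@[ext] lemma hom_ext {f g : X ⊗ Y ⟶ Z} (h₁ : inl X Y ≫ f = inl X Y ≫ g)
    (h₂ : inr X Y ≫ f = inr X Y ≫ g) : f = g :=
  coprod.hom_ext (X := X) (Y := Y) h₁ h₂

@[ext] lemma unit_ext (f g : 𝟙_ C ⟶ X) : f = g :=
  initialIsInitial.hom_ext (Y := X) f g

@[simp] lemma inl_tensorHom (f : X ⟶ X') (g : Y ⟶ Y') :
    inl X Y ≫ (f ⊗ₘ g) = f ≫ inl X' Y' :=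
  coprod.inl_map f g

@[simp] lemma inr_tensorHom (f : X ⟶ X') (g : Y ⟶ Y') :
    inr X Y ≫ (f ⊗ₘ g) = g ≫ inr X' Y' :=
  coprod.inr_map f g

@[simp] lemma inl_tensorHom_assoc (f : X ⟶ X') (g : Y ⟶ Y') (h : X' ⊗ Y' ⟶ W) :
    inl X Y ≫ (f ⊗ₘ g) ≫ h = f ≫ inl X' Y' ≫ h := by
  rw [← Category.assoc, inl_tensorHom, Category.assoc]

@[simp] lemma inr_tensorHom_assoc (f : X ⟶ X') (g : Y ⟶ Y') (h : X' ⊗ Y' ⟶ W) :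
    inr X Y ≫ (f ⊗ₘ g) ≫ h = g ≫ inr X' Y' ≫ h := by
  rw [← Category.assoc, inr_tensorHom, Category.assoc]

@[simp] lemma inl_whiskerLeft (g : Y ⟶ Y') : inl X Y ≫ X ◁ g = inl X Y' :=
  (coprod.inl_map (𝟙 X) g).trans (Category.id_comp _)

@[simp] lemma inr_whiskerLeft (g : Y ⟶ Y') : inr X Y ≫ X ◁ g = g ≫ inr X Y' :=
  coprod.inr_map (𝟙 X) g

@[simp] lemma inl_whiskerRight (f : X ⟶ X') : inl X Y ≫ f ▷ Y = f ≫ inl X' Y :=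
  coprod.inl_map f (𝟙 Y)

@[simp] lemma inr_whiskerRight (f : X ⟶ X') : inr X Y ≫ f ▷ Y = inr X' Y :=
  (coprod.inr_map f (𝟙 Y)).trans (Category.id_comp _)

@[simp] lemma inl_whiskerLeft_assoc (g : Y ⟶ Y') (h : X ⊗ Y' ⟶ W) :
    inl X Y ≫ X ◁ g ≫ h = inl X Y' ≫ h := by
  rw [← Category.assoc, inl_whiskerLeft]

@[simp] lemma inr_whiskerLeft_assoc (g : Y ⟶ Y') (h : X ⊗ Y' ⟶ W) :
    inr X Y ≫ X ◁ g ≫ h = g ≫ inr X Y' ≫ h := by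
  rw [← Category.assoc, inr_whiskerLeft, Category.assoc]

@[simp] lemma inl_whiskerRight_assoc (f : X ⟶ X') (h : X' ⊗ Y ⟶ W) :
    inl X Y ≫ f ▷ Y ≫ h = f ≫ inl X' Y ≫ h := by
  rw [← Category.assoc, inl_whiskerRight, Category.assoc]

@[simp] lemma inr_whiskerRight_assoc (f : X ⟶ X') (h : X' ⊗ Y ⟶ W) :
    inr X Y ≫ f ▷ Y ≫ h = inr X' Y ≫ h := by
  rw [← Category.assoc, inr_whiskerRight]

@[simp] lemma inr_leftUnitor : inr (𝟙_ C) X ≫ (λ_ X).hom = 𝟙 X :=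
  coprod.inr_desc _ _

@[simp] lemma inl_rightUnitor : inl X (𝟙_ C) ≫ (ρ_ X).hom = 𝟙 X :=
  coprod.inl_desc _ _

lemma leftU_inv : (λ_ X).inv = inr (𝟙_ C) X := rfl

lemma rightU_inv : (ρ_ X).inv = inl X (𝟙_ C) := rfl

lemma assoc_hom : (α_ X Y Z).hom =
    copair (copair (inl X (Y ⊗ Z)) (inl Y Z ≫ inr X (Y ⊗ Z))) (inr Y Z ≫ inr X (Y ⊗ Z)) := rfl

lemma assoc_inv : (α_ X Y Z).inv =
    copair (inl X Y ≫ inl (X ⊗ Y) Z) (copair (inr X Y ≫ inl (X ⊗ Y) Z) (inr (X ⊗ Y) Z)) := rfl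

lemma braid_hom : (β_ X Y).hom = copair (inr Y X) (inl Y X) := rfl

end Coprod

/-! ### Decorations -/

section Decorations

open Coprod Functor.LaxMonoidal

variable {C : Type u₁} [Category.{v₁} C] [HasFiniteColimits C]
  {D : Type u₂} [Category.{v₂} D] [MonoidalCategory D] [BraidedCategory D]
  (F : C ⥤ D)

/-- The tensor product of two decorations,
`I ⟶ I ⊗ I ⟶ FN ⊗ FM ⟶ F(N + M)`. -/
noncomputable def decTensor [F.LaxBraided] {N M : C} (s : 𝟙_ D ⟶ F.obj N)
    (t : 𝟙_ D ⟶ F.obj M) : 𝟙_ D ⟶ F.obj (N ⊗ M) :=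
  (λ_ (𝟙_ D)).inv ≫ (s ⊗ₘ t) ≫ μ F N M

/-- The empty decoration `I ⟶ F∅ ⟶ FN`. -/
noncomputable def emptyDec [F.LaxBraided] (N : C) : 𝟙_ D ⟶ F.obj N :=
  ε F ≫ F.map (bang N)

variable [F.LaxBraided]

lemma decTensor_natural {N M N' M' : C} (s : 𝟙_ D ⟶ F.obj N) (t : 𝟙_ D ⟶ F.obj M)
    (f : N ⟶ N') (g : M ⟶ M') :
    decTensor F (s ≫ F.map f) (t ≫ F.map g) = decTensor F s t ≫ F.map (f ⊗ₘ g) := by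
  simp [decTensor, ← tensorHom_comp_tensorHom]

lemma decTensor_comm {N M : C} (s : 𝟙_ D ⟶ F.obj N) (t : 𝟙_ D ⟶ F.obj M) :
    decTensor F s t ≫ F.map (β_ N M).hom = decTensor F t s := by
  simp [decTensor, Functor.LaxBraided.braided, unitors_inv_equal]

lemma decTensor_eq {N M : C} (s : 𝟙_ D ⟶ F.obj N) (t : 𝟙_ D ⟶ F.obj M) :
    decTensor F s t = μ (F ⋙ coyoneda.obj (op (𝟙_ D))) N M (s, t) := by
  change (λ_ (𝟙_ D)).inv ≫ (s ⊗ₘ t) ≫ μ F N M = ((λ_ (𝟙_ D)).inv ≫ (s ⊗ₘ t)) ≫ μ F N M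
  simp

lemma decTensor_assoc {N M K : C} (s : 𝟙_ D ⟶ F.obj N) (t : 𝟙_ D ⟶ F.obj M)
    (r : 𝟙_ D ⟶ F.obj K) :
    decTensor F (decTensor F s t) r ≫ F.map (α_ N M K).hom =
      decTensor F s (decTensor F t r) := by
  have h := congrArg (fun f => f ((s, t), r))
    (associativity (F ⋙ coyoneda.obj (op (𝟙_ D))) N M K)
  simp only [decTensor_eq]
  exact h

lemma decTensor_unit {N : C} (s : 𝟙_ D ⟶ F.obj N) :
    decTensor F (ε F) s ≫ F.map (λ_ N).hom = s := by
  have h := left_unitality F N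
  rw [decTensor, MonoidalCategory.tensorHom_def', Category.assoc, Category.assoc, Category.assoc,
    ← h, leftUnitor_naturality, Iso.inv_hom_id_assoc]

/-- Decorations of a fixed object form a commutative monoid. -/
@[reducible] noncomputable def decMonoid (N : C) : CommMonoid (𝟙_ D ⟶ F.obj N) where
  mul s t := decTensor F s t ≫ F.map (copair (𝟙 N) (𝟙 N))
  one := emptyDec F N
  mul_comm s t := by
    change decTensor F s t ≫ F.map _ = decTensor F t s ≫ F.map _
    rw [← decTensor_comm F s t, Category.assoc, ← F.map_comp]
    congr 2
    ext <;> simp [braid_hom]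
  mul_assoc s t r := by
    change decTensor F (decTensor F s t ≫ F.map _) r ≫ F.map _ =
      decTensor F s (decTensor F t r ≫ F.map _) ≫ F.map _
    have h₁ := decTensor_natural F (decTensor F s t) r (copair (𝟙 N) (𝟙 N)) (𝟙 N)
    have h₂ := decTensor_natural F s (decTensor F t r) (𝟙 N) (copair (𝟙 N) (𝟙 N))
    rw [F.map_id, Category.comp_id] at h₁ h₂
    rw [h₁, h₂, ← decTensor_assoc]
    simp only [Category.assoc, ← F.map_comp]
    congr 2
    ext <;> simp [assoc_hom]
  one_mul s := by
    change decTensor F (ε F ≫ F.map _) s ≫ F.map _ = s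
    have h₁ := decTensor_natural F (ε F) s (bang N) (𝟙 N)
    rw [F.map_id, Category.comp_id] at h₁
    rw [h₁]
    conv_rhs => rw [← decTensor_unit F s]
    simp only [Category.assoc, ← F.map_comp]
    congr 2
    ext; simp
  mul_one s := by
    change decTensor F s (ε F ≫ F.map _) ≫ F.map _ = s
    have h₁ := decTensor_natural F s (ε F) (𝟙 N) (bang N)
    rw [F.map_id, Category.comp_id] at h₁
    rw [h₁, ← decTensor_comm]
    conv_rhs => rw [← decTensor_unit F s]
    simp only [Category.assoc, ← F.map_comp]
    congr 2
    ext
    simp [braid_hom]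

attribute [local instance] decMonoid

lemma dec_mul_def {N : C} (s t : 𝟙_ D ⟶ F.obj N) :
    s * t = decTensor F s t ≫ F.map (copair (𝟙 N) (𝟙 N)) := rfl

lemma emptyDec_eq_one (N : C) : emptyDec F N = 1 := rfl

lemma decTensor_copair {N M P : C} (s : 𝟙_ D ⟶ F.obj N) (t : 𝟙_ D ⟶ F.obj M)
    (f : N ⟶ P) (g : M ⟶ P) :
    decTensor F s t ≫ F.map (copair f g) = (s ≫ F.map f) * (t ≫ F.map g) := by
  rw [dec_mul_def, decTensor_natural, Category.assoc, ← F.map_comp]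
  congr 2
  ext <;> simp

lemma decTensor_eq_mul {N M : C} (s : 𝟙_ D ⟶ F.obj N) (t : 𝟙_ D ⟶ F.obj M) :
    decTensor F s t = (s ≫ F.map (inl N M)) * (t ≫ F.map (inr N M)) := by
  rw [← decTensor_copair]
  have : copair (inl N M) (inr N M) = 𝟙 _ := by ext <;> simp
  simp [this]

lemma dec_mul_map {N P : C} (s t : 𝟙_ D ⟶ F.obj N) (f : N ⟶ P) :
    (s * t) ≫ F.map f = (s ≫ F.map f) * (t ≫ F.map f) := by
  rw [← decTensor_copair, dec_mul_def, Category.assoc, ← F.map_comp]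
  congr 2
  ext <;> simp

lemma dec_one_map {N P : C} (f : N ⟶ P) : (1 : 𝟙_ D ⟶ F.obj N) ≫ F.map f = 1 := by
  rw [← emptyDec_eq_one, ← emptyDec_eq_one, emptyDec, emptyDec, Category.assoc, ← F.map_comp]
  congr 2
  ext

end Decorations

/-! ### Decorated cospans -/

section DecoratedCospans

open Coprod Functor.LaxMonoidal

variable {C : Type u₁} [Category.{v₁} C] [HasFiniteColimits C]
  {D : Type u₂} [Category.{v₂} D] [MonoidalCategory D] [BraidedCategory D]
  (F : C ⥤ D)

/-- An `F`-decorated cospan from `X` to `Y`: a cospan `X ⟶ N ⟵ Y` together with a map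
`I ⟶ FN`. -/
structure DecoratedCospan (X Y : C) where
  apex : C
  left : X ⟶ apex
  right : Y ⟶ apex
  dec : 𝟙_ D ⟶ F.obj apex

namespace DecoratedCospan

variable {F}

/-- Two decorated cospans are isomorphic if there is an isomorphism of the apices compatible with
the legs and the decorations. -/
def Isomorphic {X Y : C} (a b : DecoratedCospan F X Y) : Prop :=
  ∃ e : a.apex ≅ b.apex,
    a.left ≫ e.hom = b.left ∧ a.right ≫ e.hom = b.right ∧ a.dec ≫ F.map e.hom = b.dec

variable (F) in
/-- The isomorphism relation on decorated cospans. -/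
def isoSetoid (X Y : C) : Setoid (DecoratedCospan F X Y) where
  r := Isomorphic
  iseqv :=
    { refl := fun a => ⟨Iso.refl _, by simp, by simp, by simp⟩
      symm := by
        rintro a b ⟨e, h₁, h₂, h₃⟩
        exact ⟨e.symm, by simp [← h₁], by simp [← h₂], by simp [← h₃, ← F.map_comp]⟩
      trans := by
        rintro a b c ⟨e, h₁, h₂, h₃⟩ ⟨e', h₁', h₂', h₃'⟩
        exact ⟨e ≪≫ e', by simp [← h₁', ← h₁], by simp [← h₂', ← h₂],
          by simp [← h₃', ← h₃]⟩ }

variable [F.LaxBraided]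

/-- Composition of decorated cospans: the pushout of the cospans, decorated by
`I ⟶ I ⊗ I ⟶ FN ⊗ FM ⟶ F(N + M) ⟶ F(N +_Y M)`. -/
noncomputable def comp {X Y Z : C} (a : DecoratedCospan F X Y) (b : DecoratedCospan F Y Z) :
    DecoratedCospan F X Z where
  apex := pushout a.right b.left
  left := a.left ≫ pushout.inl a.right b.left
  right := b.right ≫ pushout.inr a.right b.left
  dec := decTensor F a.dec b.dec ≫
    F.map (copair (pushout.inl a.right b.left) (pushout.inr a.right b.left))

/-- The monoidal product of decorated cospans: the coproduct of the cospans, decorated by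
`I ⟶ I ⊗ I ⟶ FN ⊗ FM ⟶ F(N + M)`. -/
noncomputable def tensor {X Y X' Y' : C} (a : DecoratedCospan F X Y)
    (b : DecoratedCospan F X' Y') : DecoratedCospan F (X ⊗ X') (Y ⊗ Y') where
  apex := a.apex ⊗ b.apex
  left := a.left ⊗ₘ b.left
  right := a.right ⊗ₘ b.right
  dec := decTensor F a.dec b.dec

variable (F) in
/-- The cospan `X ⟶ Y ⟵ Y` given by `f` and the identity, with empty decoration. -/
noncomputable def ofHom {X Y : C} (f : X ⟶ Y) : DecoratedCospan F X Y where
  apex := Y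
  left := f
  right := 𝟙 Y
  dec := emptyDec F Y

variable (F) in
/-- The cospan `Y ⟶ Y ⟵ X` given by the identity and `f`, with empty decoration. -/
noncomputable def ofOp {X Y : C} (f : X ⟶ Y) : DecoratedCospan F Y X where
  apex := Y
  left := 𝟙 Y
  right := f
  dec := emptyDec F Y

attribute [local instance] decMonoid

lemma comp_isomorphic {X Y Z P : C} (a : DecoratedCospan F X Y) (b : DecoratedCospan F Y Z)
    {p : a.apex ⟶ P} {q : b.apex ⟶ P} (h : IsPushout a.right b.left p q) :
    Isomorphic (a.comp b)
      ⟨P, a.left ≫ p, b.right ≫ q, (a.dec ≫ F.map p) * (b.dec ≫ F.map q)⟩ := by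
  refine ⟨h.isoPushout.symm, by simp [comp], by simp [comp], ?_⟩
  simp only [comp, decTensor_copair, dec_mul_map, Category.assoc, ← F.map_comp, Iso.symm_hom,
    IsPushout.inl_isoPushout_inv, IsPushout.inr_isoPushout_inv]

lemma comp_congr {X Y Z : C} {a a' : DecoratedCospan F X Y} {b b' : DecoratedCospan F Y Z}
    (ha : Isomorphic a a') (hb : Isomorphic b b') : Isomorphic (a.comp b) (a'.comp b') := by
  obtain ⟨e, h₁, h₂, h₃⟩ := ha
  obtain ⟨e', h₁', h₂', h₃'⟩ := hb
  have h : IsPushout a.right b.left (e.hom ≫ pushout.inl a'.right b'.left)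
      (e'.hom ≫ pushout.inr a'.right b'.left) :=
    IsPushout.of_iso (IsPushout.of_hasPushout a'.right b'.left) (Iso.refl _) e.symm e'.symm
      (Iso.refl _) (by simp [← h₂]) (by simp [← h₁']) (by simp) (by simp)
  refine (isoSetoid F X Z).trans (comp_isomorphic a b h) ⟨Iso.refl _, ?_, ?_, ?_⟩
  · simp [comp, ← h₁]
  · simp [comp, ← h₂']
  · simp [comp, ← h₃, ← h₃', decTensor_copair]

lemma tensor_congr {X Y X' Y' : C} {a a' : DecoratedCospan F X Y}
    {b b' : DecoratedCospan F X' Y'}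
    (ha : Isomorphic a a') (hb : Isomorphic b b') :
    Isomorphic (a.tensor b) (a'.tensor b') := by
  obtain ⟨e, h₁, h₂, h₃⟩ := ha
  obtain ⟨e', h₁', h₂', h₃'⟩ := hb
  refine ⟨MonoidalCategory.tensorIso e e', ?_, ?_, ?_⟩
  · simp [tensor, tensorHom_comp_tensorHom, h₁, h₁']
  · simp [tensor, tensorHom_comp_tensorHom, h₂, h₂']
  · simp [tensor, ← decTensor_natural, h₃, h₃']

end DecoratedCospan

/-- The category of `F`-decorated cospans.  Its objects are the objects of `C`. -/
structure FCospan {C : Type u₁} [Category.{v₁} C] {D : Type u₂} [Category.{v₂} D]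
    (F : C ⥤ D) : Type u₁ where
  of ::
  /-- The underlying object of `C`. -/
  as : C

namespace FCospan

open DecoratedCospan

variable {F} [F.LaxBraided]

/-- Morphisms are isomorphism classes of decorated cospans. -/
noncomputable instance : CategoryStruct.{max u₁ v₁ v₂} (FCospan F) where
  Hom X Y := Quotient (isoSetoid F X.as Y.as)
  id X := Quotient.mk _ (ofHom F (𝟙 X.as))
  comp := Quotient.map₂ DecoratedCospan.comp fun _ _ h _ _ h' => comp_congr h h'

/-- The morphism represented by a decorated cospan. -/
def mk {X Y : C} (a : DecoratedCospan F X Y) : (of X : FCospan F) ⟶ of Y :=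
  Quotient.mk (isoSetoid F X Y) a

/-- The morphism `X ⟶ Y ⟵ Y` with empty decoration. -/
noncomputable def J (F : C ⥤ D) [F.LaxBraided] {X Y : C} (f : X ⟶ Y) :
    (of X : FCospan F) ⟶ of Y := mk (ofHom F f)

/-- The morphism `Y ⟶ Y ⟵ X` with empty decoration. -/
noncomputable def Jop (F : C ⥤ D) [F.LaxBraided] {X Y : C} (f : X ⟶ Y) :
    (of Y : FCospan F) ⟶ of X := mk (ofOp F f)

/-- The monoidal product of morphisms. -/
noncomputable def tensorMor {X Y X' Y' : C} (a : (of X : FCospan F) ⟶ of Y)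
    (b : (of X' : FCospan F) ⟶ of Y') : (of (X ⊗ X') : FCospan F) ⟶ of (Y ⊗ Y') :=
  Quotient.map₂ (sa := isoSetoid F X Y) (sb := isoSetoid F X' Y')
    (sc := isoSetoid F (X ⊗ X') (Y ⊗ Y'))
    DecoratedCospan.tensor (fun _ _ h _ _ h' => tensor_congr h h') a b

lemma mk_surjective {X Y : C} (f : (of X : FCospan F) ⟶ of Y) :
    ∃ a : DecoratedCospan F X Y, mk a = f := Quotient.exists_rep f

lemma mk_eq_mk {X Y : C} {a b : DecoratedCospan F X Y} (h : Isomorphic a b) : mk a = mk b :=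
  Quotient.sound (s := isoSetoid F X Y) h

attribute [local instance] decMonoid

lemma mk_comp {X Y Z P : C} (a : DecoratedCospan F X Y) (b : DecoratedCospan F Y Z)
    {p : a.apex ⟶ P} {q : b.apex ⟶ P} (h : IsPushout a.right b.left p q) :
    mk a ≫ mk b =
      mk ⟨P, a.left ≫ p, b.right ≫ q, (a.dec ≫ F.map p) * (b.dec ≫ F.map q)⟩ :=
  mk_eq_mk (comp_isomorphic a b h)

lemma J_comp_mk {X Y Z : C} (f : X ⟶ Y) (a : DecoratedCospan F Y Z) :
    J F f ≫ mk a = mk ⟨a.apex, f ≫ a.left, a.right, a.dec⟩ := by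
  rw [J, mk_comp _ _ (IsPushout.of_id_fst (f := a.left))]
  simp [ofHom, emptyDec_eq_one, dec_one_map]

lemma mk_comp_Jop {X Y Z : C} (a : DecoratedCospan F X Y) (f : Z ⟶ Y) :
    mk a ≫ Jop F f = mk ⟨a.apex, a.left, f ≫ a.right, a.dec⟩ := by
  rw [Jop, mk_comp _ _ (IsPushout.of_id_snd (f := a.right))]
  simp [ofOp, emptyDec_eq_one, dec_one_map]

lemma J_comp {X Y Z : C} (f : X ⟶ Y) (g : Y ⟶ Z) : J F f ≫ J F g = J F (f ≫ g) := by
  rw [J, J, ← J, J_comp_mk]; rfl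

lemma Jop_comp {X Y Z : C} (f : X ⟶ Y) (g : Y ⟶ Z) : Jop F g ≫ Jop F f = Jop F (f ≫ g) := by
  rw [Jop, mk_comp_Jop]; rfl

lemma Jop_comp_J {X Y Z P : C} {f : X ⟶ Y} {g : X ⟶ Z} {p : Y ⟶ P} {q : Z ⟶ P}
    (h : IsPushout f g p q) : Jop F f ≫ J F g = J F p ≫ Jop F q := by
  refine (mk_comp (ofOp F f) (ofHom F g) (p := p) (q := q) h).trans
    (Eq.trans ?_ (mk_comp_Jop (ofHom F p) q).symm)
  simp [ofOp, ofHom, emptyDec_eq_one, dec_one_map]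

lemma J_eq_Jop {X Y : C} (e : X ≅ Y) : J F e.hom = Jop F e.inv := by
  refine mk_eq_mk ⟨e.symm, by simp [ofHom, ofOp], by simp [ofHom, ofOp], ?_⟩
  simp [ofHom, ofOp, emptyDec_eq_one, dec_one_map]

lemma mk_comp_J {X Y Z : C} (a : DecoratedCospan F X Y) (e : Y ≅ Z) :
    mk a ≫ J F e.hom = mk ⟨a.apex, a.left, e.inv ≫ a.right, a.dec⟩ := by
  rw [J_eq_Jop, mk_comp_Jop]

noncomputable instance : Category.{max u₁ v₁ v₂} (FCospan F) where
  id_comp {X Y} f := by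
    obtain ⟨a, rfl⟩ := mk_surjective f
    exact (J_comp_mk (𝟙 X.as) a).trans (by simp)
  comp_id {X Y} f := by
    obtain ⟨a, rfl⟩ := mk_surjective f
    exact (mk_comp_Jop a (𝟙 Y.as)).trans (by simp)
  assoc {X Y Z W} f g h := by
    obtain ⟨a, rfl⟩ := mk_surjective f
    obtain ⟨b, rfl⟩ := mk_surjective g
    obtain ⟨c, rfl⟩ := mk_surjective h
    have h₁ := IsPushout.of_hasPushout a.right b.left
    have h₂ := IsPushout.of_hasPushout b.right c.left
    have h₃ := IsPushout.of_hasPushout (pushout.inr a.right b.left) (pushout.inl b.right c.left)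
    rw [mk_comp a b h₁, mk_comp b c h₂, mk_comp _ c (h₂.paste_horiz h₃),
      mk_comp a _ (h₁.paste_vert h₃)]
    simp only [Category.assoc, dec_mul_map, ← F.map_comp, _root_.mul_assoc, h₃.w]

lemma tensorMor_mk {X Y X' Y' : C} (a : DecoratedCospan F X Y) (b : DecoratedCospan F X' Y') :
    tensorMor (mk a) (mk b) = mk (a.tensor b) := rfl

lemma id_eq_J (X : C) : 𝟙 (of X : FCospan F) = J F (𝟙 X) := rfl

lemma decTensor_empty (X Y : C) : decTensor F (emptyDec F X) (emptyDec F Y) = emptyDec F (X ⊗ Y) := by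
  simp [decTensor_eq_mul, emptyDec_eq_one, dec_one_map]

lemma tensorMor_J {X Y X' Y' : C} (f : X ⟶ Y) (g : X' ⟶ Y') :
    tensorMor (J F f) (J F g) = J F (f ⊗ₘ g) :=
  mk_eq_mk ⟨Iso.refl _, by simp [ofHom, DecoratedCospan.tensor],
    by simp [ofHom, DecoratedCospan.tensor],
    by simp [ofHom, DecoratedCospan.tensor, decTensor_empty]⟩

lemma tensorMor_Jop {X Y X' Y' : C} (f : X ⟶ Y) (g : X' ⟶ Y') :
    tensorMor (Jop F f) (Jop F g) = Jop F (f ⊗ₘ g) :=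
  mk_eq_mk ⟨Iso.refl _, by simp [ofOp, DecoratedCospan.tensor],
    by simp [ofOp, DecoratedCospan.tensor],
    by simp [ofOp, DecoratedCospan.tensor, decTensor_empty]⟩

lemma isPushout_tensor {Y N M P Y' N' M' P' : C} {f : Y ⟶ N} {g : Y ⟶ M} {p : N ⟶ P} {q : M ⟶ P}
    {f' : Y' ⟶ N'} {g' : Y' ⟶ M'} {p' : N' ⟶ P'} {q' : M' ⟶ P'}
    (h : IsPushout f g p q) (h' : IsPushout f' g' p' q') :
    IsPushout (f ⊗ₘ f') (g ⊗ₘ g') (p ⊗ₘ p') (q ⊗ₘ q') := by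
  refine ⟨⟨by simp [tensorHom_comp_tensorHom, h.w, h'.w]⟩, ⟨PushoutCocone.IsColimit.mk _
    (fun s => copair
      (h.desc (inl _ _ ≫ s.inl) (inl _ _ ≫ s.inr) ?_)
      (h'.desc (inr _ _ ≫ s.inl) (inr _ _ ≫ s.inr) ?_)) ?_ ?_ ?_⟩⟩
  · rw [← inl_tensorHom_assoc f f', ← inl_tensorHom_assoc g g', s.condition]
  · rw [← inr_tensorHom_assoc f f', ← inr_tensorHom_assoc g g', s.condition]
  · intro s; ext <;> simp
  · intro s; ext <;> simp
  · intro s m h₁ h₂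
    ext
    · apply h.hom_ext <;> simp [← h₁, ← h₂]
    · apply h'.hom_ext <;> simp [← h₁, ← h₂]

lemma tensorMor_comp {X Y Z X' Y' Z' : C} (f : (of X : FCospan F) ⟶ of Y)
    (f' : (of X' : FCospan F) ⟶ of Y') (g : (of Y : FCospan F) ⟶ of Z)
    (g' : (of Y' : FCospan F) ⟶ of Z') :
    tensorMor f f' ≫ tensorMor g g' = tensorMor (f ≫ g) (f' ≫ g') := by
  obtain ⟨a, rfl⟩ := mk_surjective f
  obtain ⟨a', rfl⟩ := mk_surjective f'
  obtain ⟨b, rfl⟩ := mk_surjective g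
  obtain ⟨b', rfl⟩ := mk_surjective g'
  have h := IsPushout.of_hasPushout a.right b.left
  have h' := IsPushout.of_hasPushout a'.right b'.left
  rw [mk_comp a b h, mk_comp a' b' h', tensorMor_mk, tensorMor_mk, tensorMor_mk,
    mk_comp (a.tensor a') (b.tensor b') (isPushout_tensor h h')]
  refine mk_eq_mk ⟨Iso.refl _, ?_, ?_, ?_⟩
  · simp [DecoratedCospan.tensor, tensorHom_comp_tensorHom]
  · simp [DecoratedCospan.tensor, tensorHom_comp_tensorHom]
  · simp only [DecoratedCospan.tensor, decTensor_eq_mul, dec_mul_map, Category.assoc,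
      ← F.map_comp, inl_tensorHom, inr_tensorHom, Iso.refl_hom, Category.comp_id]
    exact mul_mul_mul_comm _ _ _ _

lemma tensorMor_assoc {X Y X' Y' X'' Y'' : C} (f : (of X : FCospan F) ⟶ of Y)
    (f' : (of X' : FCospan F) ⟶ of Y') (f'' : (of X'' : FCospan F) ⟶ of Y'') :
    tensorMor (tensorMor f f') f'' ≫ J F (α_ Y Y' Y'').hom =
      J F (α_ X X' X'').hom ≫ tensorMor f (tensorMor f' f'') := by
  obtain ⟨a, rfl⟩ := mk_surjective f
  obtain ⟨b, rfl⟩ := mk_surjective f'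
  obtain ⟨c, rfl⟩ := mk_surjective f''
  simp only [tensorMor_mk]
  rw [mk_comp_J, J_comp_mk]
  refine mk_eq_mk ⟨α_ a.apex b.apex c.apex, ?_, ?_, ?_⟩
  · simp [DecoratedCospan.tensor]
  · simp [DecoratedCospan.tensor]
  · exact decTensor_assoc F a.dec b.dec c.dec

lemma tensorMor_leftUnitor {X Y : C} (f : (of X : FCospan F) ⟶ of Y) :
    tensorMor (𝟙 (of (𝟙_ C))) f ≫ J F (λ_ Y).hom = J F (λ_ X).hom ≫ f := by
  obtain ⟨a, rfl⟩ := mk_surjective f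
  rw [id_eq_J, J, tensorMor_mk, mk_comp_J, J_comp_mk]
  refine mk_eq_mk ⟨λ_ a.apex, ?_, ?_, ?_⟩
  · simp [DecoratedCospan.tensor, ofHom]
  · simp [DecoratedCospan.tensor, ofHom]
  · simp only [DecoratedCospan.tensor, ofHom, emptyDec_eq_one, decTensor_eq_mul, dec_one_map,
      Category.assoc, ← F.map_comp, inr_leftUnitor, F.map_id, Category.comp_id,
      _root_.one_mul]

lemma tensorMor_rightUnitor {X Y : C} (f : (of X : FCospan F) ⟶ of Y) :
    tensorMor f (𝟙 (of (𝟙_ C))) ≫ J F (ρ_ Y).hom = J F (ρ_ X).hom ≫ f := by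
  obtain ⟨a, rfl⟩ := mk_surjective f
  rw [id_eq_J, J, tensorMor_mk, mk_comp_J, J_comp_mk]
  refine mk_eq_mk ⟨ρ_ a.apex, ?_, ?_, ?_⟩
  · simp [DecoratedCospan.tensor, ofHom]
  · simp [DecoratedCospan.tensor, ofHom]
  · simp only [DecoratedCospan.tensor, ofHom, emptyDec_eq_one, decTensor_eq_mul, dec_one_map,
      Category.assoc, ← F.map_comp, inl_rightUnitor, F.map_id, Category.comp_id,
      _root_.mul_one]

lemma tensorMor_braiding {X Y X' Y' : C} (f : (of X : FCospan F) ⟶ of Y)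
    (f' : (of X' : FCospan F) ⟶ of Y') :
    tensorMor f f' ≫ J F (β_ Y Y').hom = J F (β_ X X').hom ≫ tensorMor f' f := by
  obtain ⟨a, rfl⟩ := mk_surjective f
  obtain ⟨b, rfl⟩ := mk_surjective f'
  rw [tensorMor_mk, tensorMor_mk, mk_comp_J, J_comp_mk]
  refine mk_eq_mk ⟨β_ a.apex b.apex, ?_, ?_, ?_⟩
  · simp [DecoratedCospan.tensor]
  · simp [DecoratedCospan.tensor]
  · exact decTensor_comm F a.dec b.dec

/-- An isomorphism of `C` gives an isomorphism of decorated cospans, with empty decorations. -/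
noncomputable def Jiso (F : C ⥤ D) [F.LaxBraided] {X Y : C} (e : X ≅ Y) :
    (of X : FCospan F) ≅ of Y where
  hom := J F e.hom
  inv := J F e.inv
  hom_inv_id := by rw [J_comp, e.hom_inv_id, id_eq_J]
  inv_hom_id := by rw [J_comp, e.inv_hom_id, id_eq_J]

/-- The monoidal product is the coproduct; the coherence maps are those of `(C, +)`, with empty
decorations. -/
noncomputable instance : MonoidalCategoryStruct (FCospan F) where
  tensorObj X Y := of (X.as ⊗ Y.as)
  tensorUnit := of (𝟙_ C)
  tensorHom f g := tensorMor f g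
  whiskerLeft X _ _ f := tensorMor (𝟙 X) f
  whiskerRight f X := tensorMor f (𝟙 X)
  associator X Y Z := Jiso F (α_ X.as Y.as Z.as)
  leftUnitor X := Jiso F (λ_ X.as)
  rightUnitor X := Jiso F (ρ_ X.as)

noncomputable instance : MonoidalCategory (FCospan F) :=
  MonoidalCategory.ofTensorHom
    (id_tensorHom_id := fun X Y => by
      refine (tensorMor_J (𝟙 X.as) (𝟙 Y.as)).trans ?_
      rw [id_tensorHom_id]; rfl)
    (id_tensorHom := fun _ _ _ _ => rfl)
    (tensorHom_id := fun _ _ => rfl)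
    (tensorHom_comp_tensorHom := fun f f' g g' => tensorMor_comp f f' g g')
    (associator_naturality := fun f g h => tensorMor_assoc f g h)
    (leftUnitor_naturality := fun f => tensorMor_leftUnitor f)
    (rightUnitor_naturality := fun f => tensorMor_rightUnitor f)
    (pentagon := fun W X Y Z => by
      change tensorMor (J F _) (J F (𝟙 Z.as)) ≫ J F _ ≫ tensorMor (J F (𝟙 W.as)) (J F _) =
        J F _ ≫ J F _
      simp only [tensorMor_J, J_comp, id_tensorHom, tensorHom_id]
      exact congrArg (J F) (MonoidalCategory.pentagon W.as X.as Y.as Z.as))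
    (triangle := fun X Y => by
      change J F _ ≫ tensorMor (J F (𝟙 X.as)) (J F _) = tensorMor (J F _) (J F (𝟙 Y.as))
      simp only [tensorMor_J, J_comp, id_tensorHom, tensorHom_id]
      exact congrArg (J F) (MonoidalCategory.triangle X.as Y.as))

noncomputable instance : SymmetricCategory (FCospan F) where
  braiding X Y := Jiso F (β_ X.as Y.as)
  braiding_naturality_right X _ _ f := tensorMor_braiding (𝟙 X) f
  braiding_naturality_left f Z := tensorMor_braiding f (𝟙 Z)
  hexagon_forward X Y Z := by
    change J F _ ≫ J F _ ≫ J F _ =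
      tensorMor (J F _) (J F (𝟙 Z.as)) ≫ J F _ ≫ tensorMor (J F (𝟙 Y.as)) (J F _)
    simp only [tensorMor_J, J_comp, id_tensorHom, tensorHom_id]
    exact congrArg (J F) (BraidedCategory.hexagon_forward X.as Y.as Z.as)
  hexagon_reverse X Y Z := by
    change J F _ ≫ J F _ ≫ J F _ =
      tensorMor (J F (𝟙 X.as)) (J F _) ≫ J F _ ≫ tensorMor (J F _) (J F (𝟙 Y.as))
    simp only [tensorMor_J, J_comp, id_tensorHom, tensorHom_id]
    exact congrArg (J F) (BraidedCategory.hexagon_reverse X.as Y.as Z.as)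
  symmetry X Y := by
    change J F _ ≫ J F _ = J F (𝟙 _)
    rw [J_comp, SymmetricCategory.symmetry]

/-! The Frobenius maps are the cospans given by `[1, 1]` and the unique map from the initial
object, with empty decorations. -/

/-- The codiagonal. -/
noncomputable abbrev codiag (X : C) : X ⊗ X ⟶ X := copair (𝟙 X) (𝟙 X)

lemma whiskerLeft_J (X : FCospan F) {Y Z : C} (f : Y ⟶ Z) : X ◁ J F f = J F (X.as ◁ f) := by
  rw [← id_tensorHom X.as f, ← tensorMor_J]; rfl

lemma J_whiskerRight (X : FCospan F) {Y Z : C} (f : Y ⟶ Z) : J F f ▷ X = J F (f ▷ X.as) := by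
  rw [← tensorHom_id f X.as, ← tensorMor_J]; rfl

lemma id_eq_Jop (X : C) : 𝟙 (of X : FCospan F) = Jop F (𝟙 X) := rfl

lemma whiskerLeft_Jop (X : FCospan F) {Y Z : C} (f : Y ⟶ Z) :
    X ◁ Jop F f = Jop F (X.as ◁ f) := by
  rw [← id_tensorHom X.as f, ← tensorMor_Jop]; rfl

lemma Jop_whiskerRight (X : FCospan F) {Y Z : C} (f : Y ⟶ Z) :
    Jop F f ▷ X = Jop F (f ▷ X.as) := by
  rw [← tensorHom_id f X.as, ← tensorMor_Jop]; rfl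

lemma associator_eq (X Y Z : C) : (α_ (of X : FCospan F) (of Y) (of Z)).hom =
    J F (α_ X Y Z).hom := rfl

lemma associator_inv_eq (X Y Z : C) : (α_ (of X : FCospan F) (of Y) (of Z)).inv =
    J F (α_ X Y Z).inv := rfl

lemma J_inv_eq_Jop {X Y : C} (e : X ≅ Y) : J F e.inv = Jop F e.hom := J_eq_Jop e.symm

lemma codiag_assoc (X : C) : codiag X ▷ X ≫ codiag X = (α_ X X X).hom ≫ X ◁ codiag X ≫ codiag X := by
  ext <;> simp [assoc_hom]

lemma braid_codiag (X : C) : (β_ X X).hom ≫ codiag X = codiag X := by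
  ext <;> simp [braid_hom]

lemma bang_codiag (X : C) : bang X ▷ X ≫ codiag X = (λ_ X).hom := by
  ext
  simp

lemma codiag_bang (X : C) : X ◁ bang X ≫ codiag X = (ρ_ X).hom := by
  ext
  simp

lemma isPushout_special (X : C) : IsPushout (codiag X) (codiag X) (𝟙 X) (𝟙 X) := by
  refine ⟨⟨rfl⟩, ⟨PushoutCocone.IsColimit.mk _ (fun s => s.inl) ?_ ?_ ?_⟩⟩
  · intro s; simp
  · intro s
    have h := inl X X ≫= s.condition
    simpa using h
  · intro s m h₁ h₂
    simpa using h₁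

lemma isPushout_frobenius_left (X : C) :
    IsPushout (X ◁ codiag X) ((α_ X X X).inv ≫ codiag X ▷ X) (codiag X) (codiag X) := by
  refine ⟨⟨by ext <;> simp [assoc_inv]⟩,
    ⟨PushoutCocone.IsColimit.mk _ (fun s => inl X X ≫ s.inl) ?_ ?_ ?_⟩⟩
  all_goals intro s
  · have h₁ := (inl X X ≫ inr X (X ⊗ X)) ≫= s.condition
    have h₂ := inl X (X ⊗ X) ≫= s.condition
    simp [assoc_inv] at h₁ h₂
    ext
    · simp
    · simp [h₁, h₂]
  · have h₂ := inl X (X ⊗ X) ≫= s.condition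
    have h₁ := (inl X X ≫ inr X (X ⊗ X)) ≫= s.condition
    have h₃ := (inr X X ≫ inr X (X ⊗ X)) ≫= s.condition
    simp [assoc_inv] at h₁ h₂ h₃
    ext
    · simp [h₂]
    · simp [h₂, ← h₃, h₁]
  · intro m h₁ h₂
    simp [← h₁]

lemma isPushout_frobenius_right (X : C) :
    IsPushout (codiag X ▷ X) ((α_ X X X).hom ≫ X ◁ codiag X) (codiag X) (codiag X) := by
  refine ⟨⟨by ext <;> simp [assoc_hom]⟩,
    ⟨PushoutCocone.IsColimit.mk _ (fun s => inl X X ≫ s.inl) ?_ ?_ ?_⟩⟩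
  all_goals intro s
  · have h₁ := (inr X X ≫ inl (X ⊗ X) X) ≫= s.condition
    have h₂ := inr (X ⊗ X) X ≫= s.condition
    simp [assoc_hom] at h₁ h₂
    ext
    · simp
    · simp [h₁, h₂]
  · have h₂ := (inl X X ≫ inl (X ⊗ X) X) ≫= s.condition
    have h₁ := (inr X X ≫ inl (X ⊗ X) X) ≫= s.condition
    simp [assoc_hom] at h₁ h₂
    ext
    · simp [h₂]
    · simp [h₁]
  · intro m h₁ h₂
    simp [← h₁]

/-- The special commutative Frobenius structure: `μ = [1, 1]`, `η = !`, `δ = [1, 1]ᵒᵖ`,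
`ε = !ᵒᵖ`, all with empty decorations. -/
noncomputable def frobenius (X : FCospan F) : SpecialCommFrobenius X where
  mul := J F (codiag X.as)
  one := J F (bang X.as)
  comul := Jop F (codiag X.as)
  counit := Jop F (bang X.as)
  one_mul := by
    change J F (bang X.as) ▷ X ≫ J F _ = J F (λ_ X.as).hom
    rw [J_whiskerRight]
    exact (J_comp _ _).trans (congrArg (J F) (bang_codiag X.as))
  mul_one := by
    change X ◁ J F (bang X.as) ≫ J F _ = J F (ρ_ X.as).hom
    rw [whiskerLeft_J]
    exact (J_comp _ _).trans (congrArg (J F) (codiag_bang X.as))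
  mul_assoc := by
    change J F (codiag X.as) ▷ X ≫ J F _ = J F _ ≫ X ◁ J F (codiag X.as) ≫ J F _
    rw [J_whiskerRight, whiskerLeft_J]
    refine (J_comp _ _).trans (Eq.trans ?_ (congrArg (_ ≫ ·) (J_comp _ _).symm))
    exact (congrArg (J F) (codiag_assoc X.as)).trans (J_comp _ _).symm
  counit_comul := by
    change Jop F _ ≫ Jop F (bang X.as) ▷ X = J F (λ_ X.as).inv
    rw [Jop_whiskerRight, J_inv_eq_Jop]
    exact (Jop_comp _ _).trans (congrArg (Jop F) (bang_codiag X.as))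
  comul_counit := by
    change Jop F _ ≫ X ◁ Jop F (bang X.as) = J F (ρ_ X.as).inv
    rw [whiskerLeft_Jop, J_inv_eq_Jop]
    exact (Jop_comp _ _).trans (congrArg (Jop F) (codiag_bang X.as))
  comul_assoc := by
    change Jop F _ ≫ X ◁ Jop F (codiag X.as) =
      Jop F _ ≫ Jop F (codiag X.as) ▷ X ≫ J F (α_ X.as X.as X.as).hom
    rw [Jop_whiskerRight, whiskerLeft_Jop, J_eq_Jop]
    refine (Jop_comp _ _).trans (Eq.trans ?_ (congrArg (_ ≫ ·) (Jop_comp _ _).symm))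
    refine Eq.trans (congrArg (Jop F) ?_) (Jop_comp _ _).symm
    rw [Category.assoc, codiag_assoc, Iso.inv_hom_id_assoc]
  mul_comm := by
    change J F (β_ X.as X.as).hom ≫ J F _ = J F _
    rw [J_comp, braid_codiag]
  comul_comm := by
    change Jop F _ ≫ J F (β_ X.as X.as).hom = Jop F _
    rw [J_eq_Jop, Jop_comp, ← SymmetricCategory.braiding_swap_eq_inv_braiding, braid_codiag]
  frobenius_left := by
    change X ◁ Jop F (codiag X.as) ≫ J F (α_ X.as X.as X.as).inv ≫ J F (codiag X.as) ▷ X =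
      J F _ ≫ Jop F _
    rw [whiskerLeft_Jop, J_whiskerRight]
    exact (congrArg (_ ≫ ·) (J_comp _ _)).trans (Jop_comp_J (isPushout_frobenius_left X.as))
  frobenius_right := by
    change Jop F (codiag X.as) ▷ X ≫ J F (α_ X.as X.as X.as).hom ≫ X ◁ J F (codiag X.as) =
      J F _ ≫ Jop F _
    rw [Jop_whiskerRight, whiskerLeft_J]
    exact (congrArg (_ ≫ ·) (J_comp _ _)).trans (Jop_comp_J (isPushout_frobenius_right X.as))
  special := by
    change Jop F _ ≫ J F _ = 𝟙 _
    rw [Jop_comp_J (isPushout_special X.as), ← id_eq_J, ← id_eq_Jop, Category.id_comp]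

lemma tensorμ_eq (X Y Z W : C) :
    tensorμ (of X : FCospan F) (of Y) (of Z) (of W) = J F (tensorμ X Y Z W) := by
  change J F _ ≫ (_ ◁ J F _) ≫ (_ ◁ (J F _ ▷ _)) ≫ (_ ◁ J F _) ≫ J F _ = _
  simp only [J_whiskerRight, whiskerLeft_J]
  rw [tensorμ, ← J_comp, ← J_comp, ← J_comp, ← J_comp]
  rfl

lemma codiag_tensor (X Y : C) :
    codiag (X ⊗ Y) = tensorμ X Y X Y ≫ (codiag X ⊗ₘ codiag Y) := by
  ext <;> simp [tensorμ, assoc_hom, assoc_inv, braid_hom]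

lemma J_tensorμ (X Y : C) : J F (tensorμ X X Y Y) = Jop F (tensorμ X Y X Y) := by
  have h : tensorμ X Y X Y ≫ tensorμ X X Y Y = 𝟙 _ := by
    ext <;> simp [tensorμ, assoc_hom, assoc_inv, braid_hom]
  have h' : tensorμ X X Y Y ≫ tensorμ X Y X Y = 𝟙 _ := by
    ext <;> simp [tensorμ, assoc_hom, assoc_inv, braid_hom]
  exact J_eq_Jop ⟨tensorμ X X Y Y, tensorμ X Y X Y, h', h⟩

lemma bang_tensor (X Y : C) : bang (X ⊗ Y) = (λ_ (𝟙_ C)).inv ≫ (bang X ⊗ₘ bang Y) := by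
  ext

noncomputable instance : HypergraphCategory (FCospan F) where
  frob X := frobenius X
  mul_tensor X Y := by
    rw [tensorμ_eq]
    refine (congrArg (J F) (codiag_tensor X.as Y.as)).trans ?_
    rw [← J_comp, ← tensorMor_J]
    rfl
  one_tensor X Y := by
    refine (congrArg (J F) (bang_tensor X.as Y.as)).trans ?_
    rw [← J_comp, ← tensorMor_J]
    rfl
  comul_tensor X Y := by
    rw [tensorμ_eq, J_tensorμ]
    refine (congrArg (Jop F) (codiag_tensor X.as Y.as)).trans ?_
    rw [← Jop_comp, ← tensorMor_Jop]
    rfl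
  counit_tensor X Y := by
    refine (congrArg (Jop F) (bang_tensor X.as Y.as)).trans ?_
    rw [← Jop_comp, ← tensorMor_Jop, ← J_eq_Jop]
    rfl

end FCospan

end DecoratedCospans

/-! A decorated cospan sees `D` only through the sets `D(I, FN)`. Every construction on
`F`-decorated cospans uses decorations through just three operations: transport along `F.map f`, the
empty decoration, and the tensor product of two decorations. A decoration for `D(I, F-)` is a map
from a one-point set to `D(I, FN)`, that is, a morphism `I ⟶ FN`. This bijection respects the three
operations: transport by definition, the empty decoration after removing a composite with `𝟙 I`, and
the tensor product by `decTensor_eq`.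

A `DecorationMap` abstracts a family of maps respecting the three operations. Replacing decorations
along it leaves apices and legs alone, so composites and tensor products are preserved already on
representatives (`mapCospan_comp`, `mapCospan_tensor`). The coherence and Frobenius maps carry empty
decorations, so they go to their namesakes (`mapHom_J`, `mapHom_Jop`). The result is a strict
hypergraph functor, the identity on objects, and mutually inverse decoration maps give mutually
inverse functors.

Since equality of hypergraph functors includes the structure maps, `HypergraphFunctor.ext_of_lax`
reduces it to the underlying functor, `ε` and `μ`; for the composites in question `ε` and `μ` are
identities. -/

/-! ### Equality of hypergraph functors -/

section Ext

open Functor.LaxMonoidal Functor.OplaxMonoidal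

variable {A : Type u} [Category.{v} A] [MonoidalCategory A]
  {B : Type u'} [Category.{v'} B] [MonoidalCategory B]

/-- A monoidal structure on a functor is determined by the maps `ε` and `μ`. -/
lemma CategoryTheory.Functor.Monoidal.ext_of_lax {S : A ⥤ B} (s t : S.Monoidal)
    (h : s.toLaxMonoidal = t.toLaxMonoidal) : s = t := by
  -- Two-sided inverses are unique: with a common `ε`, the `η` of `t` equals `η ≫ ε ≫ η` with the
  -- first `η` taken from `s`, which collapses to the `η` of `s`. The same argument gives `δ` from
  -- `μ`.
  have hη : s.toOplaxMonoidal.η = t.toOplaxMonoidal.η := by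
    have h₁ := t.ε_η
    rw [← h] at h₁
    rw [← Category.id_comp t.toOplaxMonoidal.η, ← s.η_ε, Category.assoc, h₁, Category.comp_id]
  have hδ : s.toOplaxMonoidal.δ = t.toOplaxMonoidal.δ := by
    ext X Y
    have h₁ := t.μ_δ X Y
    rw [← h] at h₁
    rw [← Category.id_comp (t.toOplaxMonoidal.δ X Y), ← s.δ_μ, Category.assoc, h₁,
      Category.comp_id]
  exact Functor.Monoidal.ext (congrArg (·.ε) h) (congrArg (·.μ) h) hη hδ

variable [SymmetricCategory A] [HypergraphCategory A] [SymmetricCategory B]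
  [HypergraphCategory B]

/-- Two hypergraph functors with the same underlying functor and the same maps `ε` and `μ` are
equal. -/
lemma HypergraphFunctor.ext_of_lax {S T : HypergraphFunctor A B}
    (h : S.toFunctor = T.toFunctor) (hε : ε S.toFunctor ≍ ε T.toFunctor)
    (hμ : ∀ X Y, μ S.toFunctor X Y ≍ μ T.toFunctor X Y) : S = T := by
  obtain ⟨S, s, _, _, _, _⟩ := S
  obtain ⟨T, t, _, _, _, _⟩ := T
  dsimp only at h
  -- Only once the underlying functors are identified do the two `ε` and the two `μ` have the same
  -- types, so that the heterogeneous equalities become equalities.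
  subst h
  have hl : s.toMonoidal.toLaxMonoidal = t.toMonoidal.toLaxMonoidal := by
    ext
    · exact eq_of_heq hε
    · exact eq_of_heq (hμ _ _)
  have hm := Functor.Monoidal.ext_of_lax _ _ hl
  -- Being braided is a property of the monoidal structure, as are the four Frobenius conditions, so
  -- nothing is left to compare beyond `hm`.
  have hb : s = t := by
    cases s
    cases t
    dsimp only at hm
    subst hm
    rfl
  subst hb
  rfl

end Ext

/-! ### Change of decorations -/

section ChangeOfDecorations

open Coprod Functor.LaxMonoidal

/-- A natural family of maps from the decorations for `F` to the decorations for `G`,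
compatible with empty decorations and with tensor products of decorations. -/
structure DecorationMap {C : Type u₁} [Category.{v₁} C] [HasFiniteColimits C]
    {D : Type u} [Category.{v} D] [MonoidalCategory D] [BraidedCategory D]
    {D' : Type u'} [Category.{v'} D'] [MonoidalCategory D'] [BraidedCategory D']
    (F : C ⥤ D) [F.LaxBraided] (G : C ⥤ D') [G.LaxBraided] where
  app (N : C) : (𝟙_ D ⟶ F.obj N) → (𝟙_ D' ⟶ G.obj N)
  naturality {N M : C} (s : 𝟙_ D ⟶ F.obj N) (f : N ⟶ M) :
    app M (s ≫ F.map f) = app N s ≫ G.map f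
  app_empty (N : C) : app N (emptyDec F N) = emptyDec G N
  app_tensor {N M : C} (s : 𝟙_ D ⟶ F.obj N) (t : 𝟙_ D ⟶ F.obj M) :
    app (N ⊗ M) (decTensor F s t) = decTensor G (app N s) (app M t)

namespace DecorationMap

variable {C : Type u₁} [Category.{v₁} C] [HasFiniteColimits C]
  {D : Type u} [Category.{v} D] [MonoidalCategory D] [BraidedCategory D]
  {D' : Type u'} [Category.{v'} D'] [MonoidalCategory D'] [BraidedCategory D']
  {F : C ⥤ D} [F.LaxBraided] {G : C ⥤ D'} [G.LaxBraided] (φ : DecorationMap F G)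

/-- Change of decoration of a decorated cospan. -/
def mapCospan {X Y : C} (a : DecoratedCospan F X Y) : DecoratedCospan G X Y :=
  ⟨a.apex, a.left, a.right, φ.app _ a.dec⟩

/-- The same isomorphism of apices works; its compatibility with the new decorations is naturality
along `e.hom`. -/
lemma mapCospan_congr {X Y : C} {a b : DecoratedCospan F X Y}
    (h : DecoratedCospan.Isomorphic a b) :
    DecoratedCospan.Isomorphic (φ.mapCospan a) (φ.mapCospan b) := by
  obtain ⟨e, h₁, h₂, h₃⟩ := h
  exact ⟨e, h₁, h₂, (φ.naturality _ _).symm.trans (congrArg _ h₃)⟩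

/-- An equality of representatives, not merely an isomorphism: the legs are unchanged, so both sides
use the same chosen pushout. The decorations agree by naturality along the map from the coproduct to
the pushout. -/
lemma mapCospan_comp {X Y Z : C} (a : DecoratedCospan F X Y) (b : DecoratedCospan F Y Z) :
    φ.mapCospan (a.comp b) = (φ.mapCospan a).comp (φ.mapCospan b) := by
  simp only [mapCospan, DecoratedCospan.comp, φ.naturality, φ.app_tensor]

lemma mapCospan_tensor {X Y X' Y' : C} (a : DecoratedCospan F X Y)
    (b : DecoratedCospan F X' Y') :
    φ.mapCospan (a.tensor b) = (φ.mapCospan a).tensor (φ.mapCospan b) := by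
  simp only [mapCospan, DecoratedCospan.tensor, φ.app_tensor]

lemma mapCospan_ofHom {X Y : C} (f : X ⟶ Y) :
    φ.mapCospan (.ofHom F f) = .ofHom G f := by
  simp only [mapCospan, DecoratedCospan.ofHom, φ.app_empty]

lemma mapCospan_ofOp {X Y : C} (f : X ⟶ Y) :
    φ.mapCospan (.ofOp F f) = .ofOp G f := by
  simp only [mapCospan, DecoratedCospan.ofOp, φ.app_empty]

/-! ### Action on isomorphism classes of cospans. -/

open FCospan

/-- Change of decoration of a morphism of decorated cospan categories. -/
def mapHom {X Y : C} (f : (of X : FCospan F) ⟶ of Y) : (of X : FCospan G) ⟶ of Y :=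
  Quotient.map (sa := DecoratedCospan.isoSetoid F X Y) (sb := DecoratedCospan.isoSetoid G X Y)
    φ.mapCospan (fun _ _ h => φ.mapCospan_congr h) f

lemma mapHom_mk {X Y : C} (a : DecoratedCospan F X Y) :
    φ.mapHom (FCospan.mk a) = FCospan.mk (φ.mapCospan a) := rfl

/-- Identities, associators, unitors, braidings, and the Frobenius multiplication and unit all have
the form `J F f`, so this one fact preserves them all. `mapHom_Jop` does the same for the
comultiplication and counit. -/
lemma mapHom_J {X Y : C} (f : X ⟶ Y) : φ.mapHom (J F f) = J G f :=
  congrArg FCospan.mk (φ.mapCospan_ofHom f)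

lemma mapHom_Jop {X Y : C} (f : X ⟶ Y) : φ.mapHom (Jop F f) = Jop G f :=
  congrArg FCospan.mk (φ.mapCospan_ofOp f)

lemma mapHom_comp {X Y Z : C} (f : (of X : FCospan F) ⟶ of Y) (g : (of Y : FCospan F) ⟶ of Z) :
    φ.mapHom (f ≫ g) = φ.mapHom f ≫ φ.mapHom g := by
  obtain ⟨a, rfl⟩ := mk_surjective f
  obtain ⟨b, rfl⟩ := mk_surjective g
  exact congrArg FCospan.mk (φ.mapCospan_comp a b)

lemma mapHom_tensorMor {X Y X' Y' : C} (f : (of X : FCospan F) ⟶ of Y)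
    (g : (of X' : FCospan F) ⟶ of Y') :
    φ.mapHom (tensorMor f g) = tensorMor (φ.mapHom f) (φ.mapHom g) := by
  obtain ⟨a, rfl⟩ := mk_surjective f
  obtain ⟨b, rfl⟩ := mk_surjective g
  exact congrArg FCospan.mk (φ.mapCospan_tensor a b)

/-! ### The induced strict hypergraph functor. -/

/-- The functor between decorated cospan categories that changes decorations. -/
def functor : FCospan F ⥤ FCospan G where
  obj X := of X.as
  map f := φ.mapHom f
  map_id X := φ.mapHom_J (𝟙 X.as)
  map_comp f g := φ.mapHom_comp f g

/-- Change of decorations is strict monoidal. -/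
noncomputable def coreMonoidal : φ.functor.CoreMonoidal where
  εIso := Iso.refl (of (𝟙_ C) : FCospan G)
  μIso X Y := Iso.refl (of (X.as ⊗ Y.as) : FCospan G)
  -- Whiskering is the tensor product with an identity. As the structure map is an identity,
  -- naturality says that `mapHom` preserves tensor products and identities.
  μIso_hom_natural_left {X Y} f X' := by
    refine (Category.comp_id (X := (of (X.as ⊗ X'.as) : FCospan G)) _).trans
      (Eq.trans ?_ (Category.id_comp _).symm)
    refine Eq.trans ?_ (φ.mapHom_tensorMor f (𝟙 X')).symm
    exact congrArg (tensorMor _) (φ.functor.map_id X').symm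
  μIso_hom_natural_right {X Y} X' f := by
    refine (Category.comp_id (X := (of (X'.as ⊗ X.as) : FCospan G)) _).trans
      (Eq.trans ?_ (Category.id_comp _).symm)
    refine Eq.trans ?_ (φ.mapHom_tensorMor (𝟙 X') f).symm
    exact congrArg (tensorMor · _) (φ.functor.map_id X').symm
  associativity X Y Z := by
    -- All structure maps are identities; removing them leaves the statement that the associator is
    -- sent to the associator. The unitality laws below reduce to the unitors likewise.
    change (𝟙 (of (X.as ⊗ Y.as) : FCospan G) ▷ (of Z.as)) ≫ 𝟙 _ ≫ φ.mapHom (J F _) =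
      J G _ ≫ ((of X.as : FCospan G) ◁ 𝟙 (of (Y.as ⊗ Z.as) : FCospan G)) ≫ 𝟙 _
    rw [φ.mapHom_J, id_whiskerRight, whiskerLeft_id]
    exact ((Category.id_comp _).trans (Category.id_comp _)).trans
      (((congrArg (J G _ ≫ ·) (Category.id_comp _))).trans (Category.comp_id _)).symm
  left_unitality X := by
    change J G _ = (𝟙 (of (𝟙_ C) : FCospan G) ▷ (of X.as)) ≫ 𝟙 _ ≫ φ.mapHom (J F _)
    rw [id_whiskerRight]
    exact (φ.mapHom_J _).symm.trans ((Category.id_comp _).trans (Category.id_comp _)).symm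
  right_unitality X := by
    change J G _ = ((of X.as : FCospan G) ◁ 𝟙 (of (𝟙_ C) : FCospan G)) ≫ 𝟙 _ ≫ φ.mapHom (J F _)
    rw [whiskerLeft_id]
    exact (φ.mapHom_J _).symm.trans ((Category.id_comp _).trans (Category.id_comp _)).symm

/-- Change of decorations is braided. -/
@[reducible] noncomputable def braided : φ.functor.Braided where
  toMonoidal := φ.coreMonoidal.toMonoidal
  braided X Y := by
    change 𝟙 _ ≫ φ.mapHom (J F _) = J G _ ≫ 𝟙 _
    rw [φ.mapHom_J]
    exact (Category.id_comp _).trans (Category.comp_id _).symm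

/-- The hypergraph functor that changes decorations. -/
noncomputable def hypergraphFunctor : HypergraphFunctor (FCospan F) (FCospan G) where
  toFunctor := φ.functor
  braided := φ.braided
  map_mul _ := (φ.mapHom_J _).symm.trans (Category.id_comp _).symm
  map_one _ := (φ.mapHom_J _).symm.trans (Category.id_comp _).symm
  -- `δ` and `η` are the inverses of the identity isomorphisms `μ` and `ε`, hence identities.
  map_comul _ := (φ.mapHom_Jop _).symm.trans (Category.comp_id _).symm
  map_counit _ := (φ.mapHom_Jop _).symm.trans (Category.comp_id _).symm

/-! ### Mutually inverse changes of decorations. -/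

lemma mapHom_mapHom_of_leftInverse (ψ : DecorationMap G F)
    (h : ∀ N, Function.LeftInverse (ψ.app N) (φ.app N)) {X Y : C}
    (f : (of X : FCospan F) ⟶ of Y) : ψ.mapHom (φ.mapHom f) = f := by
  obtain ⟨a, rfl⟩ := mk_surjective f
  simp only [mapHom_mk, mapCospan, h a.apex a.dec]

/-- Stated for a one-sided inverse so that it yields both equations of the isomorphism, with `φ` and
`ψ` exchanged. -/
lemma hypergraphFunctor_comp_of_leftInverse (ψ : DecorationMap G F)
    (h : ∀ N, Function.LeftInverse (ψ.app N) (φ.app N)) :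
    φ.hypergraphFunctor.comp ψ.hypergraphFunctor = HypergraphFunctor.id (FCospan F) := by
  refine HypergraphFunctor.ext_of_lax ?_ (heq_of_eq ?_) (fun X Y => heq_of_eq ?_)
  · exact CategoryTheory.Functor.ext (fun _ => rfl) fun _ _ f =>
      (φ.mapHom_mapHom_of_leftInverse ψ h f).trans
        ((Category.id_comp _).trans (Category.comp_id _)).symm
  · change 𝟙 _ ≫ ψ.mapHom (𝟙 (of (𝟙_ C))) = 𝟙 (of (𝟙_ C))
    exact (Category.id_comp _).trans (ψ.functor.map_id (of (𝟙_ C)))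
  · change 𝟙 _ ≫ ψ.mapHom (𝟙 (of (X.as ⊗ Y.as))) = 𝟙 (of (X.as ⊗ Y.as))
    exact (Category.id_comp _).trans (ψ.functor.map_id (of (X.as ⊗ Y.as)))

end DecorationMap

end ChangeOfDecorations

/-! ### Decorations as elements of a set -/

section HomDecorations

open Functor.LaxMonoidal

variable {C : Type u₁} [Category.{v₁} C] [HasFiniteColimits C]
  {D : Type u₂} [Category.{v₂} D] [MonoidalCategory D] [BraidedCategory D]
  (F : C ⥤ D) [F.LaxBraided]

/-- A map `s : I ⟶ FN` regarded as the element `s : * ⟶ D(I, FN)`. -/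
def homDecoration : DecorationMap F (F ⋙ coyoneda.obj (op (𝟙_ D))) where
  app N s := ↾fun _ => s
  naturality s f := rfl
  app_empty N := by
    ext
    -- The unit map of `D(I, -)` picks out `𝟙 I`, so that of the composite functor picks out `𝟙 I ≫
    -- ε F`.
    change ε F ≫ F.map _ = (𝟙 _ ≫ ε F) ≫ F.map _
    rw [Category.id_comp]
  app_tensor s t := by
    ext
    exact decTensor_eq F s t

/-- An element `* ⟶ D(I, FN)` regarded as a map `I ⟶ FN`. -/
def evalDecoration : DecorationMap (F ⋙ coyoneda.obj (op (𝟙_ D))) F where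
  app N s := s PUnit.unit
  naturality s f := rfl
  app_empty N := by
    change (𝟙 _ ≫ ε F) ≫ F.map _ = ε F ≫ F.map _
    rw [Category.id_comp]
  app_tensor s t := (decTensor_eq F _ _).symm

end HomDecorations

theorem mainTheorem10 (C : Type u₁) [Category.{v₁} C] [HasFiniteColimits C]
    (D : Type u₂) [Category.{v₂} D] [MonoidalCategory D] [BraidedCategory D]
    (F : C ⥤ D) [F.LaxBraided] :
    HypergraphIsomorphic (FCospan F) (FCospan (F ⋙ coyoneda.obj (op (𝟙_ D)))) := by
  refine ⟨(homDecoration F).hypergraphFunctor, (evalDecoration F).hypergraphFunctor,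
    DecorationMap.hypergraphFunctor_comp_of_leftInverse _ _ fun N s => rfl,
    DecorationMap.hypergraphFunctor_comp_of_leftInverse _ _ fun N s => ?_⟩
  -- The other composite evaluates a constant map, which is definitional. Here a map out of a
  -- one-point set is recovered from its value, which needs extensionality.
  ext
  rfl
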